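/- Let $R$ be an associative ring with $1$. "Module" means unital right $R$-module. For a class $\mathcal C$ of modules put ${}^\perp\mathcal C=\{M : \mathrm{Ext}^1_R(M,C)=0 \text{ for all } C\in\mathcal C\}$ and $\mathcal C^\perp=\{M : \mathrm{Ext}^1_R(C,M)=0 \text{ for all } C\in\mathcal C\}$. A submodule $N\subseteq M$ is pure if $N\otimes_R X\to M\otimes_R X$ is injective for every left $R$-module $X$. A countable direct limit is the direct limit of a direct system indexed by a (nonempty) countable directed set. A module is countably presented if it is isomorphic to $F/K$ with $F$ free of countable rank and $K$ countably generated (countable includes finite). For a class $\mathcal Q$ of left $R$-modules, $\mathcal D_{\mathcal Q}$ denotes the class of all flat modules $M$ that are $\mathcal Q$-Mittag-Leffler, i.e. such that for every family $(Q_i)_{i\in I}$ of modules in $\mathcal Q$ the canonical map $M\otimes_R\prod_{i\in I} Q_i\to\prod_{i\in I}(M\otimes_R Q_i)$ is injective. (1) Let $\mathcal A'$ be a class of modules closed under products (up to isomorphism). Assume that $\mathcal A'\subseteq\mathcal A={}^\perp\mathcal C$ for some class of modules $\mathcal C$, and that $\mathcal A$ is closed under pure submodules. Then $\mathcal A$ contains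 all countable direct limits of modules in $\mathcal A'$. (2) Let $\mathcal Q$ be a class of left $R$-modules such that $\mathcal D_{\mathcal Q}$ is closed under products. Then ${}^\perp(\mathcal D_{\mathcal Q}^\perp)$ contains all countable direct limits of modules in $\mathcal D_{\mathcal Q}$. In particular, every countably presented flat module belongs to ${}^\perp(\mathcal D_{\mathcal Q}^\perp)$. (3) If $R$ is left Noetherian, then $\mathcal D_{\mathcal Q}$ is closed under products for every class $\mathcal Q$ of left $R$-modules (so the conclusions of (2) hold). -/

import Mathlib

open CategoryTheory
open scoped TensorProduct

universe u

noncomputable section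

namespace RightMod

/-! Right `R`-modules are modules over `Rᵐᵒᵖ`, with `m · r = MulOpposite.op r • m`. -/

section Tensor

variable (R : Type u) [Ring R]

/-- The relations `(m · r) ⊗ n = m ⊗ (r • n)` inside `M ⊗ N` over the integers. -/
def balancedRelations (M N : Type u) [AddCommGroup M] [Module Rᵐᵒᵖ M]
    [AddCommGroup N] [Module R N] : Submodule ℤ (M ⊗[ℤ] N) :=
  Submodule.span ℤ
    {t | ∃ (m : M) (r : R) (n : N), t = (MulOpposite.op r • m) ⊗ₜ[ℤ] n - m ⊗ₜ[ℤ] (r • n)}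

/-- The tensor product over an arbitrary ring `R` of a right module `M` and a left module `N`,
an abelian group. -/
abbrev Tensor (M N : Type u) [AddCommGroup M] [Module Rᵐᵒᵖ M]
    [AddCommGroup N] [Module R N] : Type u :=
  (M ⊗[ℤ] N) ⧸ balancedRelations R M N

variable {R}

theorem balancedRelations_le_comap {M M' N N' : Type u}
    [AddCommGroup M] [Module Rᵐᵒᵖ M] [AddCommGroup M'] [Module Rᵐᵒᵖ M']
    [AddCommGroup N] [Module R N] [AddCommGroup N'] [Module R N']
    (f : M →ₗ[Rᵐᵒᵖ] M') (g : N →ₗ[R] N') :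
    balancedRelations R M N ≤ (balancedRelations R M' N').comap
      (TensorProduct.map f.toAddMonoidHom.toIntLinearMap g.toAddMonoidHom.toIntLinearMap) := by
  refine Submodule.span_le.2 ?_
  rintro _ ⟨m, r, n, rfl⟩
  refine Submodule.subset_span ⟨f m, r, g n, ?_⟩
  simp

/-- The homomorphism `f ⊗ g`. -/
def Tensor.map {M M' N N' : Type u}
    [AddCommGroup M] [Module Rᵐᵒᵖ M] [AddCommGroup M'] [Module Rᵐᵒᵖ M']
    [AddCommGroup N] [Module R N] [AddCommGroup N'] [Module R N']
    (f : M →ₗ[Rᵐᵒᵖ] M') (g : N →ₗ[R] N') : Tensor R M N →ₗ[ℤ] Tensor R M' N' :=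
  Submodule.mapQ _ _
    (TensorProduct.map f.toAddMonoidHom.toIntLinearMap g.toAddMonoidHom.toIntLinearMap)
    (balancedRelations_le_comap f g)

/-- The canonical homomorphism `ρ : M ⊗ ∏ i, Q i → ∏ i, M ⊗ Q i`. -/
def tensorPi (R : Type u) [Ring R] (M : Type u) [AddCommGroup M] [Module Rᵐᵒᵖ M]
    {I : Type u} (Q : I → Type u) [∀ i, AddCommGroup (Q i)] [∀ i, Module R (Q i)] :
    Tensor R M (∀ i, Q i) →ₗ[ℤ] ∀ i, Tensor R M (Q i) :=
  LinearMap.pi fun i => Tensor.map LinearMap.id (LinearMap.proj i)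

end Tensor

variable {R : Type u} [Ring R]

/-- A right module `M` is flat if `M ⊗ -` preserves injectivity of maps of left modules. -/
def IsFlat (R : Type u) [Ring R] (M : Type u) [AddCommGroup M] [Module Rᵐᵒᵖ M] : Prop :=
  ∀ ⦃N N' : Type u⦄ [AddCommGroup N] [Module R N] [AddCommGroup N'] [Module R N']
    (g : N →ₗ[R] N'), Function.Injective g →
      Function.Injective (Tensor.map (LinearMap.id : M →ₗ[Rᵐᵒᵖ] M) g)

/-- `M` is Mittag-Leffler relative to the class `𝒬` of left modules: for every family of members
of `𝒬` the canonical map `ρ` is injective. -/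
def IsMittagLeffler (𝒬 : ObjectProperty (ModuleCat.{u} R))
    (M : Type u) [AddCommGroup M] [Module Rᵐᵒᵖ M] : Prop :=
  ∀ ⦃I : Type u⦄ (Q : I → ModuleCat.{u} R), (∀ i, 𝒬 (Q i)) →
    Function.Injective (tensorPi R M fun i => (Q i : Type u))

/-- The class of flat right modules that are Mittag-Leffler relative to `𝒬`. -/
def flatMittagLeffler (𝒬 : ObjectProperty (ModuleCat.{u} R)) :
    ObjectProperty (ModuleCat.{u} Rᵐᵒᵖ) :=
  fun M => IsFlat R M ∧ IsMittagLeffler 𝒬 M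

/-- A submodule `N` of a right module `M` is pure if `N ⊗ X → M ⊗ X` is injective for every
left module `X`. -/
def IsPure {M : Type u} [AddCommGroup M] [Module Rᵐᵒᵖ M] (N : Submodule Rᵐᵒᵖ M) : Prop :=
  ∀ (X : Type u) [AddCommGroup X] [Module R X],
    Function.Injective (Tensor.map N.subtype (LinearMap.id : X →ₗ[R] X))

/-- `M` has a presentation `0 → K → F → M → 0` with `F` free of countable rank and `K` countably
generated. -/
def IsCountablyPresented (R : Type u) [Ring R] (M : Type u) [AddCommGroup M] [Module Rᵐᵒᵖ M] : Prop :=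
  ∃ (ι : Type) (_ : Countable ι) (p : (ι →₀ Rᵐᵒᵖ) →ₗ[Rᵐᵒᵖ] M), Function.Surjective p ∧
    ∃ S : Set (ι →₀ Rᵐᵒᵖ), S.Countable ∧ Submodule.span Rᵐᵒᵖ S = LinearMap.ker p

/-! Classes of right modules. -/

/-- `⊥𝒞`: the modules `M` with `Ext¹(M, C) = 0` for all `C` in `𝒞`. -/
def leftPerp (𝒞 : ObjectProperty (ModuleCat.{u} Rᵐᵒᵖ)) : ObjectProperty (ModuleCat.{u} Rᵐᵒᵖ) :=
  fun M => ∀ C, 𝒞 C → Subsingleton (Abelian.Ext.{u} M C 1)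

/-- `𝒞⊥`: the modules `M` with `Ext¹(C, M) = 0` for all `C` in `𝒞`. -/
def rightPerp (𝒞 : ObjectProperty (ModuleCat.{u} Rᵐᵒᵖ)) : ObjectProperty (ModuleCat.{u} Rᵐᵒᵖ) :=
  fun M => ∀ C, 𝒞 C → Subsingleton (Abelian.Ext.{u} C M 1)

/-- The direct product of any family of members of `𝒜` is isomorphic to a member of `𝒜`. -/
def ClosedUnderProducts (𝒜 : ObjectProperty (ModuleCat.{u} Rᵐᵒᵖ)) : Prop :=
  ∀ ⦃I : Type u⦄ (M : I → ModuleCat.{u} Rᵐᵒᵖ), (∀ i, 𝒜 (M i)) →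
    𝒜.isoClosure (ModuleCat.of Rᵐᵒᵖ (∀ i, M i))

def ClosedUnderPureSubmodules (𝒜 : ObjectProperty (ModuleCat.{u} Rᵐᵒᵖ)) : Prop :=
  ∀ M : ModuleCat.{u} Rᵐᵒᵖ, 𝒜 M → ∀ N : Submodule Rᵐᵒᵖ M,
    IsPure N → 𝒜 (ModuleCat.of Rᵐᵒᵖ N)

/-- `𝒜` contains the direct limit of every direct system of members of `𝒜'` indexed by a countable
directed set. -/
def ContainsCountableDirectLimits (𝒜 𝒜' : ObjectProperty (ModuleCat.{u} Rᵐᵒᵖ)) : Prop :=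
  ∀ (J : Type) [Preorder J] [IsDirectedOrder J] [Nonempty J] [Countable J]
    (F : J ⥤ ModuleCat.{u} Rᵐᵒᵖ), (∀ j, 𝒜' (F.obj j)) →
      ∀ c : Limits.Cocone F, Limits.IsColimit c → 𝒜 c.pt

end RightMod

end

/-! Along a cofinal sequence, a countable direct limit `M` becomes the limit of some `A 0 → A 1 →
⋯`. Take the tree of finite sequences in a set `X`, put a copy of `A n` at each node of level `n`,
and let `L` consist of the families in the product over all nodes that eventually follow the
transition maps along each branch and vanish outside finitely many branches and finitely many nodes.
Limits along branches give an exact sequence `0 → K → L → M^(B) → 0`, where `K` is the direct sum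
over the nodes and `B = X^ℕ` is the set of branches. Since `L` is locally split, hence pure, in a
product of modules from the class, `Ext¹(L, C) = 0`, and `Hom(K, C)` maps onto `Ext¹(M^(B), C)`.

If `Ext¹(M, C)` had a nonzero element, the target would have at least `2^|B|` elements. But `X` can
be taken at least as large as `C` and all `A n`, with `2^|X| ≤ |X^ℕ|`; then `|Hom(K, C)| ≤ 2^|X| ≤
|B|`, against Cantor's theorem. This is `subsingleton_ext_of_treeModule`; purity comes from
`exists_map_fixing`.

Part (2) holds because flatness and the relative Mittag-Leffler property pass to pure submodules,
and because a countably presented flat module is the limit of a sequence of finitely generated free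
modules (`IsFlat.exists_sequence`). For (3), finitely generated left modules over a left Noetherian
ring are finitely presented, so after tensoring a product with one of them, zero is detected
coordinatewise (`eq_zero_of_map_proj_eq_zero`). -/

noncomputable section

namespace RightMod

/-! ### Tensor products over a noncommutative ring. -/

section TensorCalculus

variable {R : Type u} [Ring R]
variable {M M' N N' : Type u} [AddCommGroup M] [Module Rᵐᵒᵖ M] [AddCommGroup M'] [Module Rᵐᵒᵖ M']
  [AddCommGroup N] [Module R N] [AddCommGroup N'] [Module R N']

/-- The pure tensor `m ⊗ n`. -/
def Tensor.tmul (R : Type u) [Ring R] {M N : Type u} [AddCommGroup M] [Module Rᵐᵒᵖ M]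
    [AddCommGroup N] [Module R N] (m : M) (n : N) : Tensor R M N :=
  Submodule.Quotient.mk (m ⊗ₜ[ℤ] n)

namespace Tensor

theorem add_tmul (m m' : M) (n : N) : tmul R (m + m') n = tmul R m n + tmul R m' n := by
  simp [tmul, TensorProduct.add_tmul]

theorem tmul_add (m : M) (n n' : N) : tmul R m (n + n') = tmul R m n + tmul R m n' := by
  simp [tmul, TensorProduct.tmul_add]

theorem smul_tmul (m : M) (r : R) (n : N) :
    tmul R (MulOpposite.op r • m) n = tmul R m (r • n) :=
  (Submodule.Quotient.eq _).2 (Submodule.subset_span ⟨m, r, n, rfl⟩)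

@[simp]
theorem map_tmul (f : M →ₗ[Rᵐᵒᵖ] M') (g : N →ₗ[R] N') (m : M) (n : N) :
    Tensor.map f g (tmul R m n) = tmul R (f m) (g n) := rfl

/-- `m ↦ m ⊗ n` as an additive map. -/
def tmulLeft (n : N) : M →+ Tensor R M N :=
  AddMonoidHom.mk' (fun m => tmul R m n) fun _ _ => add_tmul _ _ _

/-- `n ↦ m ⊗ n` as an additive map. -/
def tmulRight (m : M) : N →+ Tensor R M N :=
  AddMonoidHom.mk' (fun n => tmul R m n) fun _ _ => tmul_add _ _ _

theorem sum_tmul {ι : Type*} (s : Finset ι) (m : ι → M) (n : N) :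
    tmul R (∑ i ∈ s, m i) n = ∑ i ∈ s, tmul R (m i) n :=
  map_sum (tmulLeft n) m s

theorem tmul_sum {ι : Type*} (s : Finset ι) (m : M) (n : ι → N) :
    tmul R m (∑ i ∈ s, n i) = ∑ i ∈ s, tmul R m (n i) :=
  map_sum (tmulRight m) n s

@[simp]
theorem tmul_zero (m : M) : tmul R m (0 : N) = 0 := map_zero (tmulRight m)

@[elab_as_elim]
theorem induction {p : Tensor R M N → Prop} (t : Tensor R M N) (zero : p 0)
    (tmul : ∀ m n, p (tmul R m n)) (add : ∀ x y, p x → p y → p (x + y)) : p t := by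
  induction t using Submodule.Quotient.induction_on with
  | H z =>
    induction z using TensorProduct.induction_on with
    | zero => simpa using zero
    | tmul m n => exact tmul m n
    | add x y hx hy => rw [Submodule.Quotient.mk_add]; exact add _ _ hx hy

theorem hom_ext {P : Type*} [AddCommGroup P] {f g : Tensor R M N →ₗ[ℤ] P}
    (h : ∀ m n, f (tmul R m n) = g (tmul R m n)) : f = g := by
  refine LinearMap.ext fun t => ?_
  induction t using Tensor.induction with
  | zero => simp
  | tmul m n => exact h m n
  | add x y hx hy => simp [hx, hy]

/-- The homomorphism induced by a balanced biadditive map. -/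
def lift {P : Type*} [AddCommGroup P] (f : M →+ N →+ P)
    (h : ∀ m (r : R) n, f (MulOpposite.op r • m) n = f m (r • n)) : Tensor R M N →ₗ[ℤ] P :=
  Submodule.liftQ _ (TensorProduct.liftAddHom f (by intro r m n; simp)).toIntLinearMap <| by
    refine Submodule.span_le.2 ?_
    rintro _ ⟨m, r, n, rfl⟩
    simp [h]

theorem map_map {M'' N'' : Type u} [AddCommGroup M''] [Module Rᵐᵒᵖ M''] [AddCommGroup N'']
    [Module R N''] (f : M →ₗ[Rᵐᵒᵖ] M') (g : N →ₗ[R] N') (f' : M' →ₗ[Rᵐᵒᵖ] M'')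
    (g' : N' →ₗ[R] N'') (t : Tensor R M N) :
    Tensor.map f' g' (Tensor.map f g t) = Tensor.map (f' ∘ₗ f) (g' ∘ₗ g) t := by
  have : (Tensor.map f' g') ∘ₗ (Tensor.map f g) = Tensor.map (f' ∘ₗ f) (g' ∘ₗ g) :=
    hom_ext fun m n => by simp
  exact LinearMap.congr_fun this t

theorem map_id_id (t : Tensor R M N) :
    Tensor.map (LinearMap.id : M →ₗ[Rᵐᵒᵖ] M) (LinearMap.id : N →ₗ[R] N) t = t := by
  have : Tensor.map (LinearMap.id : M →ₗ[Rᵐᵒᵖ] M) (LinearMap.id : N →ₗ[R] N) = LinearMap.id :=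
    hom_ext fun m n => by simp
  exact LinearMap.congr_fun this t

theorem exists_eq_sum (t : Tensor R M N) :
    ∃ (k : ℕ) (m : Fin k → M) (n : Fin k → N), t = ∑ i, tmul R (m i) (n i) := by
  induction t using Tensor.induction with
  | zero => exact ⟨0, 0, 0, by simp⟩
  | tmul m n => exact ⟨1, fun _ => m, fun _ => n, by simp⟩
  | add x y hx hy =>
    obtain ⟨k, m, n, rfl⟩ := hx
    obtain ⟨l, m', n', rfl⟩ := hy
    exact ⟨k + l, Fin.append m m', Fin.append n n', by simp [Fin.sum_univ_add]⟩

/-- Every element of `M ⊗ N` comes from `M ⊗ A` for a finitely generated submodule `A`. -/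
theorem exists_fg_preimage (t : Tensor R M N) :
    ∃ (A : Submodule R N), A.FG ∧
      ∃ t' : Tensor R M A, Tensor.map LinearMap.id A.subtype t' = t := by
  obtain ⟨k, m, n, rfl⟩ := exists_eq_sum t
  refine ⟨Submodule.span R (Set.range n), Submodule.fg_span (Set.finite_range n),
    ∑ i, tmul R (m i) ⟨n i, Submodule.subset_span ⟨i, rfl⟩⟩, ?_⟩
  simp

/-- Right exactness of `M ⊗ -`. -/
theorem exists_of_map_eq_zero (g : N →ₗ[R] N') (hg : Function.Surjective g) (t : Tensor R M N)
    (ht : Tensor.map LinearMap.id g t = 0) :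
    ∃ s : Tensor R M (LinearMap.ker g), Tensor.map LinearMap.id (LinearMap.ker g).subtype s = t := by
  obtain ⟨z, rfl⟩ := Submodule.Quotient.mk_surjective _ t
  let i₀ := (LinearMap.ker g).subtype.toAddMonoidHom.toIntLinearMap
  let g₀ := g.toAddMonoidHom.toIntLinearMap
  have hz : (TensorProduct.map LinearMap.id g₀) z ∈ balancedRelations R M N' :=
    (Submodule.Quotient.mk_eq_zero _).1 ht
  -- As `g` is onto, the balanced relations on `M ⊗ N'` lift. So a representative of `t` can be
  -- corrected by a relation to lie in the kernel over the integers, where right exactness applies.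
  have hle : balancedRelations R M N' ≤
      (balancedRelations R M N).map (TensorProduct.map LinearMap.id g₀) := by
    refine Submodule.span_le.2 ?_
    rintro _ ⟨m, r, n, rfl⟩
    obtain ⟨n, rfl⟩ := hg n
    exact ⟨_, Submodule.subset_span ⟨m, r, n, rfl⟩, by simp [g₀]⟩
  obtain ⟨w, hw, hwz⟩ := hle hz
  have hex : Function.Exact i₀ g₀ := fun x => by
    constructor
    · intro hx
      exact ⟨⟨x, hx⟩, rfl⟩
    · rintro ⟨y, rfl⟩
      exact y.2
  have hzero : (g₀.lTensor M) (z - w) = 0 := by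
    rw [map_sub, sub_eq_zero]; exact hwz.symm
  obtain ⟨v, hv⟩ := (lTensor_exact M hex hg (z - w)).1 hzero
  refine ⟨Submodule.Quotient.mk v, ?_⟩
  change Submodule.Quotient.mk (i₀.lTensor M v) = _
  rw [hv]
  refine (Submodule.Quotient.eq _).2 ?_
  rw [sub_sub_cancel_left]
  exact neg_mem hw


/-- The coordinate map `M ⊗ R^k → M`. -/
def coordRight {k : ℕ} (i : Fin k) : Tensor R M (Fin k → R) →ₗ[ℤ] M :=
  lift (AddMonoidHom.mk' (fun m => AddMonoidHom.mk' (fun c => MulOpposite.op (c i) • m)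
      fun a b => by simp [add_smul]) fun a b => by ext; simp)
    fun m r c => by simp [smul_smul]

@[simp]
theorem coordRight_tmul {k : ℕ} (i : Fin k) (m : M) (c : Fin k → R) :
    coordRight i (tmul R m c) = MulOpposite.op (c i) • m := rfl

/-- The coordinate map `R^k ⊗ N → N`. -/
def coordLeft {k : ℕ} (i : Fin k) : Tensor R (Fin k → Rᵐᵒᵖ) N →ₗ[ℤ] N :=
  lift (AddMonoidHom.mk' (fun c => AddMonoidHom.mk' (fun n => (c i).unop • n)
      fun a b => by simp) fun a b => by ext; simp [add_smul])
    fun c r n => by simp [smul_smul]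

@[simp]
theorem coordLeft_tmul {k : ℕ} (i : Fin k) (c : Fin k → Rᵐᵒᵖ) (n : N) :
    coordLeft i (tmul R c n) = (c i).unop • n := rfl

theorem coordLeft_map {k : ℕ} (i : Fin k) (g : N →ₗ[R] N') (t : Tensor R (Fin k → Rᵐᵒᵖ) N) :
    coordLeft i (Tensor.map LinearMap.id g t) = g (coordLeft i t) := by
  induction t using Tensor.induction with
  | zero => simp
  | tmul c n => simp
  | add x y hx hy => simp [hx, hy]

theorem eq_zero_of_coordLeft {k : ℕ} (t : Tensor R (Fin k → Rᵐᵒᵖ) N)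
    (ht : ∀ i, coordLeft i t = 0) : t = 0 := by
  have key : t = ∑ i, tmul R (Pi.single i 1 : Fin k → Rᵐᵒᵖ) (coordLeft i t) := by
    clear ht
    induction t using Tensor.induction with
    | zero => simp
    | tmul c n =>
      simp only [coordLeft_tmul, ← smul_tmul, MulOpposite.op_unop, ← sum_tmul]
      congr 1
      ext j
      simp [Finset.sum_apply, Pi.single_apply]
    | add x y hx hy =>
      simp only [map_add, tmul_add, Finset.sum_add_distrib, ← hx, ← hy]
  rw [key]
  simp [ht]

/-- The vanishing criterion: if the `a i` generate `A` and `∑ m i ⊗ a i = 0`, then the `m i` are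
combinations of relations between the `a i`. -/
theorem exists_relations_of_sum_tmul_eq_zero {k : ℕ} (a : Fin k → N)
    (ha : Submodule.span R (Set.range a) = ⊤) (m : Fin k → M)
    (h : ∑ i, tmul R (m i) (a i) = 0) :
    ∃ (l : ℕ) (κ : Fin l → Fin k → R) (y : Fin l → M),
      (∀ s, ∑ i, κ s i • a i = 0) ∧ ∀ i, m i = ∑ s, MulOpposite.op (κ s i) • y s := by
  let g : (Fin k → R) →ₗ[R] N := Fintype.linearCombination R a
  have hg : Function.Surjective g := by
    rw [← LinearMap.range_eq_top, Fintype.range_linearCombination, ha]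
  have hgs (i : Fin k) : g (Pi.single i 1) = a i := by
    simp [g, Fintype.linearCombination_apply_single]
  -- The element `∑ m i ⊗ e i` has coordinates `m i` and dies in `M ⊗ N`, so it comes from the
  -- relation module `ker g`.
  obtain ⟨s, hs⟩ := exists_of_map_eq_zero g hg
    (∑ i, tmul R (m i) (Pi.single i 1 : Fin k → R)) (by simpa [hgs] using h)
  obtain ⟨l, y, κ, rfl⟩ := exists_eq_sum s
  refine ⟨l, fun s => κ s, y, fun s => ?_, fun i => ?_⟩
  · have := LinearMap.mem_ker.1 (κ s).2
    rwa [Fintype.linearCombination_apply] at this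
  · have := congrArg (coordRight i) hs
    simp only [map_sum, map_tmul, coordRight_tmul, Pi.single_apply] at this
    rw [Finset.sum_eq_single i (fun j _ hj => by simp [hj.symm]) (by simp)] at this
    simpa using this.symm

/-- The converse of the vanishing criterion. -/
theorem sum_tmul_eq_zero_of_relations {k l : ℕ} (a : Fin k → N) (κ : Fin l → Fin k → R)
    (y : Fin l → M) (m : Fin k → M) (hκ : ∀ s, ∑ i, κ s i • a i = 0)
    (hm : ∀ i, m i = ∑ s, MulOpposite.op (κ s i) • y s) :
    ∑ i, tmul R (m i) (a i) = 0 := by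
  simp only [hm, sum_tmul, smul_tmul]
  rw [Finset.sum_comm]
  simp [← tmul_sum, hκ]

end Tensor
end TensorCalculus

/-! ### Products over a left Noetherian ring. -/

section Products

variable {R : Type u} [Ring R]

/-- Over a left Noetherian ring, `(∏ M j) ⊗ A → ∏ (M j ⊗ A)` is injective for `A` finitely
generated. -/
theorem eq_zero_of_map_proj_eq_zero [IsNoetherianRing R] {J : Type u} (M : J → Type u)
    [∀ j, AddCommGroup (M j)] [∀ j, Module Rᵐᵒᵖ (M j)] {A : Type u} [AddCommGroup A] [Module R A]
    [Module.Finite R A] (t : Tensor R (∀ j, M j) A)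
    (ht : ∀ j, Tensor.map (LinearMap.proj j : (∀ j, M j) →ₗ[Rᵐᵒᵖ] M j)
      (LinearMap.id : A →ₗ[R] A) t = 0) : t = 0 := by
  obtain ⟨k, a, ha⟩ := Module.Finite.exists_fin (R := R) (M := A)
  have key : ∃ m : Fin k → ∀ j, M j, t = ∑ i, Tensor.tmul R (m i) (a i) := by
    clear ht
    induction t using Tensor.induction with
    | zero => exact ⟨0, by simp [Tensor.tmul]⟩
    | tmul m n =>
      have hn : n ∈ Submodule.span R (Set.range a) := ha ▸ Submodule.mem_top
      obtain ⟨c, rfl⟩ := (Submodule.mem_span_range_iff_exists_fun R).1 hn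
      exact ⟨fun i => MulOpposite.op (c i) • m, by simp [Tensor.tmul_sum, Tensor.smul_tmul]⟩
    | add x y hx hy =>
      obtain ⟨m, rfl⟩ := hx
      obtain ⟨m', rfl⟩ := hy
      exact ⟨m + m', by simp [Tensor.add_tmul, Finset.sum_add_distrib]⟩
  obtain ⟨m, rfl⟩ := key
  let g : (Fin k → R) →ₗ[R] A := Fintype.linearCombination R a
  obtain ⟨l, κ, hκ⟩ := Submodule.fg_iff_exists_fin_generating_family.1
    (IsNoetherian.noetherian (LinearMap.ker g))
  have hκ0 (s : Fin l) : ∑ i, κ s i • a i = 0 := by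
    have : κ s ∈ LinearMap.ker g := hκ ▸ Submodule.subset_span ⟨s, rfl⟩
    simpa [g, Fintype.linearCombination_apply] using this
  -- The relations found for each `j` vary with `j`; rewriting them through the fixed finite family
  -- `κ` lets the coefficients be assembled into elements of the product.
  have hy (j : J) : ∃ y : Fin l → M j, ∀ i, m i j = ∑ s, MulOpposite.op (κ s i) • y s := by
    obtain ⟨l', κ', y', hκ', hm'⟩ :=
      Tensor.exists_relations_of_sum_tmul_eq_zero (M := M j) a ha (fun i => m i j)
        (by simpa using ht j)
    have hc (s' : Fin l') : ∃ c : Fin l → R, ∑ s, c s • κ s = κ' s' := by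
      refine (Submodule.mem_span_range_iff_exists_fun R).1 ?_
      rw [hκ]
      simpa [g, Fintype.linearCombination_apply] using hκ' s'
    choose c hc using hc
    refine ⟨fun s => ∑ s', MulOpposite.op (c s' s) • y' s', fun i => ?_⟩
    rw [hm']
    simp only [Finset.smul_sum, ← hc, Finset.sum_apply, Pi.smul_apply, smul_eq_mul,
      Finset.op_sum, MulOpposite.op_mul, Finset.sum_smul, mul_smul]
    exact Finset.sum_comm
  choose y hy using hy
  refine Tensor.sum_tmul_eq_zero_of_relations a κ (fun s j => y j s) m hκ0 fun i => ?_
  ext j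
  simp [hy, Finset.sum_apply]

/-- A kernel element lives over a finitely generated `A`, where it is tested in each coordinate;
flatness of `M j` applies to `A → N → N'`. -/
theorem isFlat_pi [IsNoetherianRing R] {J : Type u} (M : J → Type u)
    [∀ j, AddCommGroup (M j)] [∀ j, Module Rᵐᵒᵖ (M j)] (h : ∀ j, IsFlat R (M j)) :
    IsFlat R (∀ j, M j) := by
  intro N N' _ _ _ _ g hg
  rw [injective_iff_map_eq_zero]
  intro t ht
  obtain ⟨A, hA, t', rfl⟩ := Tensor.exists_fg_preimage t
  have : Module.Finite R A := Module.Finite.iff_fg.2 hA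
  rw [eq_zero_of_map_proj_eq_zero M t', map_zero]
  intro j
  refine h j (g ∘ₗ A.subtype) (hg.comp A.injective_subtype) ?_
  have := congrArg (Tensor.map (LinearMap.proj j : (∀ j, M j) →ₗ[Rᵐᵒᵖ] M j) LinearMap.id) ht
  simp only [Tensor.map_map, map_zero] at this ⊢
  exact this

/-- Flatness embeds `M j ⊗ A` in `M j ⊗ ∏ Q i`, where the Mittag-Leffler condition on `M j` applies.
-/
theorem isMittagLeffler_pi [IsNoetherianRing R] {𝒬 : ObjectProperty (ModuleCat.{u} R)}
    {J : Type u} (M : J → Type u)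
    [∀ j, AddCommGroup (M j)] [∀ j, Module Rᵐᵒᵖ (M j)] (h : ∀ j, IsFlat R (M j))
    (h' : ∀ j, IsMittagLeffler 𝒬 (M j)) :
    IsMittagLeffler 𝒬 (∀ j, M j) := by
  intro I Q hQ
  rw [injective_iff_map_eq_zero]
  intro t ht
  obtain ⟨A, hA, t', rfl⟩ := Tensor.exists_fg_preimage t
  have : Module.Finite R A := Module.Finite.iff_fg.2 hA
  rw [eq_zero_of_map_proj_eq_zero M t', map_zero]
  intro j
  refine h j A.subtype A.injective_subtype (h' j Q hQ ?_)
  rw [map_zero, map_zero]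
  ext i
  have := congrArg (Tensor.map (LinearMap.proj j : (∀ j, M j) →ₗ[Rᵐᵒᵖ] M j) LinearMap.id)
    (congrFun ht i)
  simp only [tensorPi, LinearMap.pi_apply, Tensor.map_map, Pi.zero_apply, map_zero] at this ⊢
  exact this

theorem closedUnderProducts_flatMittagLeffler [IsNoetherianRing R]
    (𝒬 : ObjectProperty (ModuleCat.{u} R)) : ClosedUnderProducts (flatMittagLeffler 𝒬) :=
  fun _ _ hM => ObjectProperty.le_isoClosure _ _
    ⟨isFlat_pi _ fun i => (hM i).1, isMittagLeffler_pi _ (fun i => (hM i).1) fun i => (hM i).2⟩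

end Products

/-! ### Pure embeddings, finitely generated free modules, flatness by equations. -/

section Pure

variable {R : Type u} [Ring R] {M N : Type u} [AddCommGroup M] [Module Rᵐᵒᵖ M]
  [AddCommGroup N] [Module Rᵐᵒᵖ N]

/-- A homomorphism that stays injective under tensor products. -/
def IsPureEmbedding (j : N →ₗ[Rᵐᵒᵖ] M) : Prop :=
  ∀ (X : Type u) [AddCommGroup X] [Module R X],
    Function.Injective (Tensor.map j (LinearMap.id : X →ₗ[R] X))

theorem isPureEmbedding_of_comp_eq_id {j : N →ₗ[Rᵐᵒᵖ] M} {q : M →ₗ[Rᵐᵒᵖ] N}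
    (h : q ∘ₗ j = LinearMap.id) : IsPureEmbedding j := fun X _ _ =>
  Function.LeftInverse.injective (g := Tensor.map q LinearMap.id) fun t => by
    rw [Tensor.map_map, h]
    exact Tensor.map_id_id t

theorem IsPureEmbedding.isFlat {j : N →ₗ[Rᵐᵒᵖ] M} (hj : IsPureEmbedding j) (h : IsFlat R M) :
    IsFlat R N := by
  intro X Y _ _ _ _ g hg
  refine Function.Injective.of_comp (f := Tensor.map j LinearMap.id) ?_
  have : (Tensor.map j LinearMap.id ∘ Tensor.map LinearMap.id g) =
      (Tensor.map LinearMap.id g ∘ Tensor.map j LinearMap.id) := by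
    ext t
    simp only [Function.comp, Tensor.map_map]
    rfl
  rw [this]
  exact (h g hg).comp (hj X)

theorem IsPureEmbedding.isMittagLeffler {𝒬 : ObjectProperty (ModuleCat.{u} R)}
    {j : N →ₗ[Rᵐᵒᵖ] M} (hj : IsPureEmbedding j) (h : IsMittagLeffler 𝒬 M) :
    IsMittagLeffler 𝒬 N := by
  intro I Q hQ
  refine Function.Injective.of_comp
    (f := fun (x : ∀ i, Tensor R N (Q i)) i => Tensor.map j LinearMap.id (x i)) ?_
  have : ((fun (x : ∀ i, Tensor R N (Q i)) i => Tensor.map j LinearMap.id (x i)) ∘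
      tensorPi R N fun i => (Q i : Type u)) =
      (tensorPi R M fun i => (Q i : Type u)) ∘ Tensor.map j LinearMap.id := by
    ext t i
    simp only [Function.comp, tensorPi, LinearMap.pi_apply, Tensor.map_map]
    rfl
  rw [this]
  exact (h Q hQ).comp (hj _)

/-- A submodule is pure if each finite family in it is fixed by a homomorphism of the whole module
into it. -/
theorem isPure_of_locally_split {N : Submodule Rᵐᵒᵖ M}
    (h : ∀ (k : ℕ) (n : Fin k → N), ∃ φ : M →ₗ[Rᵐᵒᵖ] N, ∀ i, φ (n i) = n i) : IsPure N := by
  intro X _ _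
  rw [injective_iff_map_eq_zero]
  intro t ht
  obtain ⟨k, n, x, rfl⟩ := Tensor.exists_eq_sum t
  obtain ⟨φ, hφ⟩ := h k n
  simpa [hφ] using congrArg (Tensor.map φ LinearMap.id) ht

theorem isFlat_fin (k : ℕ) : IsFlat R (Fin k → Rᵐᵒᵖ) := by
  intro N N' _ _ _ _ g hg
  rw [injective_iff_map_eq_zero]
  intro t ht
  refine Tensor.eq_zero_of_coordLeft t fun i => (injective_iff_map_eq_zero g).1 hg _ ?_
  rw [← Tensor.coordLeft_map, ht, map_zero]

theorem isMittagLeffler_fin (𝒬 : ObjectProperty (ModuleCat.{u} R)) (k : ℕ) :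
    IsMittagLeffler 𝒬 (Fin k → Rᵐᵒᵖ) := by
  intro I Q _
  rw [injective_iff_map_eq_zero]
  intro t ht
  refine Tensor.eq_zero_of_coordLeft t fun i => funext fun q => ?_
  have := Tensor.coordLeft_map i (LinearMap.proj q : (∀ i, (Q i : Type u)) →ₗ[R] Q q) t
  rw [LinearMap.proj_apply] at this
  rw [← this]
  exact (congrArg _ (congrFun ht q)).trans (map_zero _)

/-- The equational criterion: in a flat module, a relation `∑ m i · r i = 0` is a consequence of
relations in a free module. -/
theorem IsFlat.exists_factorization (h : IsFlat R M) {k : ℕ} (m : Fin k → M) (r : Fin k → R)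
    (hr : ∑ i, MulOpposite.op (r i) • m i = 0) :
    ∃ (l : ℕ) (κ : Fin l → Fin k → R) (y : Fin l → M),
      (∀ s, ∑ i, κ s i * r i = 0) ∧ ∀ i, m i = ∑ s, MulOpposite.op (κ s i) • y s := by
  let I := Submodule.span R (Set.range r)
  let a : Fin k → I := fun i => ⟨r i, Submodule.subset_span ⟨i, rfl⟩⟩
  have ha : Submodule.span R (Set.range a) = ⊤ := by
    have : Set.range a = ((↑) : I → R) ⁻¹' Set.range r := by
      ext x
      simp [a, Subtype.ext_iff]
    rw [this]
    exact Submodule.span_span_coe_preimage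
  -- `M ⊗ I → M ⊗ R` is injective, and in `M ⊗ R` the sum becomes `(∑ m i · r i) ⊗ 1 = 0`.
  have h0 : ∑ i, Tensor.tmul R (m i) (a i) = 0 := by
    refine h I.subtype I.injective_subtype ?_
    have e (i : Fin k) : Tensor.tmul R (m i) (r i) =
        Tensor.tmul R (MulOpposite.op (r i) • m i) (1 : R) := by simp [Tensor.smul_tmul]
    simp only [map_sum, Tensor.map_tmul, map_zero, LinearMap.id_apply]
    simp only [I, a, Submodule.subtype_apply, e, ← Tensor.sum_tmul, hr]
    exact map_zero (Tensor.tmulLeft (1 : R))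
  obtain ⟨l, κ, y, hκ, hm⟩ := Tensor.exists_relations_of_sum_tmul_eq_zero a ha m h0
  exact ⟨l, κ, y, fun s => by simpa [a] using congrArg Subtype.val (hκ s), hm⟩

end Pure

/-! ### Vanishing of `Ext¹` by counting homomorphisms. -/

section ExtCounting

open Abelian

/-- If `K → L → M^(B)` is a short exact sequence such that `Ext¹(L, C) = 0` and there are fewer
homomorphisms `K → C` than subsets of `B`, then `Ext¹(M, C) = 0`. -/
theorem subsingleton_ext_of_no_injection {S : Type u} [Ring S] {B K L M : Type u}
    [AddCommGroup K] [Module S K] [AddCommGroup L] [Module S L] [AddCommGroup M] [Module S M]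
    (C : ModuleCat.{u} S) (i : K →ₗ[S] L) (p : L →ₗ[S] (B →₀ M)) (hi : Function.Injective i)
    (hp : Function.Surjective p) (hip : Function.Exact i p)
    (hL : Subsingleton (Ext.{u} (ModuleCat.of S L) C 1))
    (hK : ∀ d : Set B → (K →ₗ[S] C), ¬ Function.Injective d) :
    Subsingleton (Ext.{u} (ModuleCat.of S M) C 1) := by
  classical
  refine subsingleton_of_forall_eq 0 fun ξ => ?_
  by_contra hξ
  let T : ShortComplex (ModuleCat.{u} S) :=
    ShortComplex.mk (ModuleCat.ofHom i) (ModuleCat.ofHom p)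
      (ModuleCat.hom_ext (LinearMap.ext hip.apply_apply_eq_zero))
  have hT : T.ShortExact := ShortComplex.ShortExact.mk'
    ((ShortComplex.ShortExact.moduleCat_exact_iff_function_exact T).2 hip)
    ((ModuleCat.mono_iff_injective _).2 hi) ((ModuleCat.epi_iff_surjective _).2 hp)
  -- Pulling `ξ` back along the sum of the coordinates in `s` gives a class with component `ξ` at `b
  -- ∈ s` and `0` elsewhere. As `ξ ≠ 0`, this class determines `s`.
  let σ (s : Set B) : (B →₀ M) →ₗ[S] M :=
    Finsupp.lsum ℕ fun b => if b ∈ s then LinearMap.id else 0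
  let cls (s : Set B) : Ext.{u} T.X₃ C 1 :=
    (Ext.mk₀ (ModuleCat.ofHom (σ s) : T.X₃ ⟶ ModuleCat.of S M)).comp ξ (zero_add 1)
  have hcls (s : Set B) (b : B) :
      (Ext.mk₀ (ModuleCat.ofHom (Finsupp.lsingle b) : ModuleCat.of S M ⟶ T.X₃)).comp (cls s)
        (zero_add 1) = if b ∈ s then ξ else 0 := by
    have hσ : σ s ∘ₗ Finsupp.lsingle b = if b ∈ s then LinearMap.id else 0 := by
      ext m
      simp [σ]
    rw [Ext.mk₀_comp_mk₀_assoc, ← ModuleCat.ofHom_comp, hσ]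
    split_ifs
    · exact Ext.mk₀_id_comp ξ
    · rw [ModuleCat.ofHom_zero, Ext.mk₀_zero, Ext.zero_comp]
  -- Since `Ext¹(L, C) = 0`, the connecting map from `Hom(K, C)` is onto.
  have hex (s : Set B) : ∃ d : K →ₗ[S] C,
      hT.extClass.comp (Ext.mk₀ (ModuleCat.ofHom d : T.X₁ ⟶ C)) (add_zero 1) = cls s := by
    obtain ⟨x, hx⟩ := Ext.contravariant_sequence_exact₃ hT C (cls s) (hL.elim _ _) (add_zero 1)
    obtain ⟨d, rfl⟩ := Ext.homEquiv₀.symm.surjective x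
    exact ⟨d.hom, hx⟩
  choose d hd using hex
  refine hK d fun s t hst => ?_
  have hc : cls s = cls t := by rw [← hd, ← hd, hst]
  ext b
  have := hcls s b
  rw [hc, hcls t b] at this
  by_cases hs : b ∈ s <;> by_cases ht : b ∈ t <;> simp_all

theorem leftPerp_of_iso {R : Type u} [Ring R] {𝒞 : ObjectProperty (ModuleCat.{u} Rᵐᵒᵖ)}
    {M N : ModuleCat.{u} Rᵐᵒᵖ} (e : M ≅ N) (hN : leftPerp 𝒞 N) : leftPerp 𝒞 M := by
  refine fun C hC => subsingleton_of_forall_eq 0 fun ξ => ?_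
  have h : (Ext.mk₀ e.hom).comp ((Ext.mk₀ e.inv).comp ξ (zero_add 1)) (zero_add 1) = ξ := by
    rw [Ext.mk₀_comp_mk₀_assoc, e.hom_inv_id, Ext.mk₀_id_comp]
  rw [← h, (hN C hC).elim ((Ext.mk₀ e.inv).comp ξ (zero_add 1)) 0, Ext.comp_zero]

end ExtCounting

/-! ### Sets with as many sequences as subsets. -/

section Cardinality

/-- There are arbitrarily large types with as many countable sequences as subsets. -/
theorem exists_embedding_set_into_seq (Z : Type u) :
    ∃ X : Type u, Nonempty (Z ↪ X) ∧ Nonempty (Set X ↪ (ℕ → X)) := by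
  -- Iterated power sets: a subset of the disjoint union is determined by its traces on the stages,
  -- and its trace on `T n` is a point of `T (n + 1)`.
  let T : ℕ → Type u := Nat.rec Z fun _ Y => Set Y
  refine ⟨Σ n, T n, ⟨⟨fun z => ⟨0, z⟩, fun a b h => by simpa using h⟩⟩,
    ⟨⟨fun s n => ⟨n + 1, ({t : T n | (⟨n, t⟩ : Σ n, T n) ∈ s} : Set (T n))⟩, fun s t h => ?_⟩⟩⟩
  ext ⟨n, x⟩
  have h1 := congrFun h n
  have h2 : ({x : T n | (⟨n, x⟩ : Σ n, T n) ∈ s} : Set (T n)) =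
      {x : T n | (⟨n, x⟩ : Σ n, T n) ∈ t} := by simpa using h1
  exact Set.ext_iff.1 h2 x

end Cardinality

/-! ### The tree module of a sequence and its local splitting. -/

section Tree

open Filter

/-- The nodes of the tree of finite sequences in `X`. -/
abbrev Node (X : Type u) : Type u := Σ n : ℕ, (Fin n → X)

/-- The node of level `n` on the branch `b`. -/
abbrev branchNode {X : Type u} (b : ℕ → X) (n : ℕ) : Node X := ⟨n, fun i => b i⟩

theorem branchNode_eq_iff {X : Type u} {b : ℕ → X} {n : ℕ} {η : Node X} :
    η = branchNode b n ↔ η.1 = n ∧ η.2 = fun i : Fin η.1 => b i := by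
  constructor
  · rintro rfl
    exact ⟨rfl, rfl⟩
  · obtain ⟨k, a⟩ := η
    rintro ⟨h, h'⟩
    subst h
    simpa using h'

theorem branchNode_injective {X : Type u} (b : ℕ → X) : Function.Injective (branchNode b) :=
  fun _ _ h => congrArg Sigma.fst h

theorem eventually_branchNode_notMem {X : Type u} (b : ℕ → X) {s : Set (Node X)} (hs : s.Finite) :
    ∀ᶠ n in atTop, branchNode b n ∉ s := by
  rw [← Nat.cofinite_eq_atTop]
  exact (hs.preimage (branchNode_injective b).injOn).eventually_cofinite_notMem

theorem eventually_branchNode_ne {X : Type u} {b b' : ℕ → X} (h : b ≠ b') :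
    ∀ᶠ n in atTop, ∀ m, branchNode b n ≠ branchNode b' m := by
  obtain ⟨k, hk⟩ := Function.ne_iff.1 h
  filter_upwards [eventually_gt_atTop k] with n hn m he
  obtain ⟨-, h2⟩ := branchNode_eq_iff.1 he
  exact hk (congrFun h2 ⟨k, hn⟩)

variable {S : Type u} [Ring S] {A : ℕ → Type u} [∀ n, AddCommGroup (A n)] [∀ n, Module S (A n)]
  (f : ∀ n, A n →ₗ[S] A (n + 1))

/-- The composite transition map `A N → A n`. -/
def transition {N n : ℕ} (h : N ≤ n) : A N →ₗ[S] A n :=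
  Nat.leRec (motive := fun m _ => A N →ₗ[S] A m) LinearMap.id (fun k _ g => f k ∘ₗ g) h

@[simp]
theorem transition_self (N : ℕ) : transition f (le_refl N) = LinearMap.id :=
  Nat.leRec_self ..

theorem transition_succ {N n : ℕ} (h : N ≤ n) :
    transition f (h.trans n.le_succ) = f n ∘ₗ transition f h :=
  Nat.leRec_succ ..

theorem eq_transition {N : ℕ} {x : ∀ n, A n} (hx : ∀ n, N ≤ n → x (n + 1) = f n (x n)) {n : ℕ}
    (h : N ≤ n) : x n = transition f h (x N) := by
  induction n, h using Nat.le_induction with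
  | base => simp
  | succ n h ih => rw [hx n h, ih, transition_succ f h]; rfl

/-- The sequence that starts with an element of `A N`. -/
def thread (N : ℕ) : A N →ₗ[S] ∀ n, A n :=
  LinearMap.pi fun n => if h : N ≤ n then transition f h else 0

theorem thread_of_le {N n : ℕ} (h : N ≤ n) (x : A N) : thread f N x n = transition f h x := by
  simp [thread, h]

theorem thread_of_lt {N n : ℕ} (h : n < N) (x : A N) : thread f N x n = 0 := by
  simp [thread, h.not_ge]

theorem thread_succ {N n : ℕ} (h : N ≤ n) (x : A N) :
    thread f N x (n + 1) = f n (thread f N x n) := by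
  rw [thread_of_le f h, thread_of_le f (h.trans n.le_succ), transition_succ f h]
  rfl

/-- The families on the tree that are eventually threads along each branch, and that vanish outside
finitely many branches and finitely many nodes. -/
def treeModule (X : Type u) : Submodule S (∀ η : Node X, A η.1) where
  carrier := {y | (∀ b : ℕ → X, ∀ᶠ n in atTop,
      y (branchNode b (n + 1)) = f n (y (branchNode b n))) ∧
    ∃ W : Finset (ℕ → X), {η | y η ≠ 0 ∧ ∀ b ∈ W, ∀ n, η ≠ branchNode b n}.Finite}
  add_mem' := by
    classical
    rintro y z ⟨hy, W, hW⟩ ⟨hz, V, hV⟩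
    refine ⟨fun b => ?_, W ∪ V, (hW.union hV).subset ?_⟩
    · filter_upwards [hy b, hz b] with n h1 h2
      simp [h1, h2]
    · rintro η ⟨h1, h2⟩
      by_cases h : y η = 0
      · exact Or.inr ⟨by simpa [h] using h1, fun b hb => h2 b (Finset.mem_union_right _ hb)⟩
      · exact Or.inl ⟨h, fun b hb => h2 b (Finset.mem_union_left _ hb)⟩
  zero_mem' := ⟨by simp, ∅, by simp⟩
  smul_mem' := by
    rintro c y ⟨hy, W, hW⟩
    refine ⟨fun b => ?_, W, hW.subset ?_⟩
    · filter_upwards [hy b] with n h1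
      simp [h1]
    · rintro η ⟨h1, h2⟩
      exact ⟨fun h => h1 (by simp [h]), h2⟩

variable {X : Type u}

/-- The inclusion of the families with finite support. -/
def finiteSupportEmb : (Π₀ η : Node X, A η.1) →ₗ[S] treeModule f X :=
  (DFinsupp.coeFnLinearMap S).codRestrict _ fun y => by
    classical
    have hy : {η | y η ≠ 0}.Finite :=
      y.support.finite_toSet.subset fun η hη => by simpa using hη
    refine ⟨fun b => ?_, ∅, hy.subset fun η hη => hη.1⟩
    have h1 := eventually_branchNode_notMem b hy
    filter_upwards [h1, (tendsto_add_atTop_nat 1).eventually h1] with n h1 h2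
    simp only [not_not] at h1 h2
    simp [h1, h2]

@[simp]
theorem finiteSupportEmb_apply (y : Π₀ η : Node X, A η.1) (η : Node X) :
    (finiteSupportEmb f y).1 η = y η := rfl

open Classical in
/-- A sequence spread along a branch of the tree. -/
def spread (b : ℕ → X) : (∀ n, A n) →ₗ[S] ∀ η : Node X, A η.1 :=
  LinearMap.pi fun η => if η.2 = (fun i : Fin η.1 => b i) then LinearMap.proj η.1 else 0

theorem spread_branchNode (b : ℕ → X) (x : ∀ n, A n) (n : ℕ) :
    spread (S := S) b x (branchNode b n) = x n := by
  simp [spread]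

theorem spread_of_ne (b : ℕ → X) (x : ∀ n, A n) {η : Node X} (h : ∀ n, η ≠ branchNode b n) :
    spread (S := S) b x η = 0 := by
  have : η.2 ≠ fun i : Fin η.1 => b i := fun e => h η.1 (branchNode_eq_iff.2 ⟨rfl, e⟩)
  simp [spread, this]

theorem spread_mem (b : ℕ → X) {x : ∀ n, A n} (hx : ∀ᶠ n in atTop, x (n + 1) = f n (x n)) :
    spread (S := S) b x ∈ treeModule f X := by
  refine ⟨fun b' => ?_, {b}, ?_⟩
  · by_cases h : b' = b
    · subst h
      simpa only [spread_branchNode] using hx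
    · have h1 := eventually_branchNode_ne h
      filter_upwards [h1, (tendsto_add_atTop_nat 1).eventually h1] with n h1 h2
      rw [spread_of_ne b x h1, spread_of_ne b x h2, map_zero]
  · convert Set.finite_empty
    ext η
    simp only [Finset.mem_singleton, forall_eq, Set.mem_ofPred_eq, Set.mem_empty_iff_false,
      iff_false, not_and]
    exact fun h1 h2 => h1 (spread_of_ne b x h2)

/-- The thread of an element of `A N`, spread along a branch. -/
def threadEmb (b : ℕ → X) (N : ℕ) : A N →ₗ[S] treeModule f X :=
  (spread b ∘ₗ thread f N).codRestrict _ fun x => spread_mem f b <| by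
    filter_upwards [eventually_ge_atTop N] with n hn
    exact thread_succ f hn x

theorem coe_threadEmb (b : ℕ → X) (N : ℕ) (x : A N) :
    (threadEmb f b N x).1 = spread (S := S) b (thread f N x) := rfl

/-- Above a high level `N`, the finitely many branches involved are disjoint and each `y i` is a
thread along them. So `y i` is determined by its values at level `N` of these branches and at
finitely many further nodes; `φ` reads these coordinates and rebuilds the family. -/
theorem exists_map_fixing {k : ℕ} (y : Fin k → treeModule f X) :
    ∃ φ : (∀ η : Node X, A η.1) →ₗ[S] treeModule f X, ∀ i, φ (y i) = y i := by
  classical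
  choose hy W hW using fun i => (y i).2
  let V : Finset (ℕ → X) := Finset.univ.biUnion W
  have hthr : ∀ᶠ N in atTop, ∀ i, ∀ b ∈ V, ∀ n, N ≤ n →
      (y i).1 (branchNode b (n + 1)) = f n ((y i).1 (branchNode b n)) := by
    rw [eventually_all]
    intro i
    rw [Finset.eventually_all]
    intro b _
    exact eventually_forall_ge_atTop.2 (hy i b)
  have hdist : ∀ᶠ N in atTop, ∀ b ∈ V, ∀ b' ∈ V, b ≠ b' → ∀ n, N ≤ n → ∀ m,
      branchNode b n ≠ branchNode b' m := by
    rw [Finset.eventually_all]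
    intro b _
    rw [Finset.eventually_all]
    intro b' _
    rw [eventually_imp_distrib_left]
    intro h
    exact eventually_forall_ge_atTop.2 (eventually_branchNode_ne h)
  obtain ⟨N, hthr, hdist⟩ := (hthr.and hdist).exists
  let tail : Set (Node X) := {η | ∃ b ∈ V, ∃ n, N ≤ n ∧ η = branchNode b n}
  -- Off the tails, `y i` lives on its finite exceptional set and on the levels below `N` of the
  -- chosen branches.
  have hfin : (⋃ i, {η | (y i).1 η ≠ 0 ∧ η ∉ tail}).Finite := by
    refine Set.finite_iUnion fun i => ?_
    have hI : (⋃ b ∈ V, ⋃ n ∈ Finset.range N, {branchNode b n} : Set (Node X)).Finite :=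
      V.finite_toSet.biUnion fun b _ => (Finset.range N).finite_toSet.biUnion fun n _ =>
        Set.finite_singleton _
    refine ((hW i).union hI).subset ?_
    rintro η ⟨h1, h2⟩
    by_cases h : ∀ b ∈ W i, ∀ n, η ≠ branchNode b n
    · exact Or.inl ⟨h1, h⟩
    · push Not at h
      obtain ⟨b, hb, n, rfl⟩ := h
      have hbV : b ∈ V := Finset.mem_biUnion.2 ⟨i, Finset.mem_univ _, hb⟩
      have hn : n < N := by
        by_contra hn
        exact h2 ⟨b, hbV, n, not_lt.1 hn, rfl⟩
      refine Or.inr ?_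
      simp only [Set.mem_iUnion, Finset.mem_range]
      exact ⟨b, hbV, n, hn, rfl⟩
  let F : Finset (Node X) := hfin.toFinset
  have hF (η : Node X) : η ∈ F ↔ ∃ i, (y i).1 η ≠ 0 ∧ η ∉ tail := by simp [F]
  refine ⟨∑ η ∈ F, finiteSupportEmb f ∘ₗ DFinsupp.lsingle η ∘ₗ LinearMap.proj η +
    ∑ b ∈ V, threadEmb f b N ∘ₗ LinearMap.proj (branchNode b N), fun i => ?_⟩
  ext η
  have e1 : (∑ θ ∈ F, (finiteSupportEmb f (DFinsupp.single θ ((y i).1 θ))).1) η =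
      if η ∈ F then (y i).1 η else 0 := by
    simp only [Finset.sum_apply, finiteSupportEmb_apply]
    split_ifs with h
    · rw [Finset.sum_eq_single_of_mem η h fun θ _ hθ => DFinsupp.single_eq_of_ne hθ.symm,
        DFinsupp.single_eq_same]
    · exact Finset.sum_eq_zero fun θ hθ =>
        DFinsupp.single_eq_of_ne fun e => h (e ▸ hθ)
  have e2 : (∑ b ∈ V, (threadEmb f b N ((y i).1 (branchNode b N))).1) η =
      if η ∈ tail then (y i).1 η else 0 := by
    simp only [Finset.sum_apply, coe_threadEmb]
    split_ifs with h
    · obtain ⟨b, hb, n, hn, rfl⟩ := h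
      rw [Finset.sum_eq_single_of_mem b hb fun b' hb' hne =>
        spread_of_ne _ _ (hdist b hb b' hb' hne.symm n hn), spread_branchNode, thread_of_le f hn]
      exact (eq_transition f (x := fun n => (y i).1 (branchNode b n)) (hthr i b hb) hn).symm
    · refine Finset.sum_eq_zero fun b hb => ?_
      by_cases hη : ∃ n, η = branchNode b n
      · obtain ⟨n, rfl⟩ := hη
        rw [spread_branchNode]
        refine thread_of_lt f ?_ _
        by_contra hn
        exact h ⟨b, hb, n, not_lt.1 hn, rfl⟩
      · exact spread_of_ne _ _ (not_exists.1 hη)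
  have e3 : (y i).1 η = (if η ∈ F then (y i).1 η else 0) +
      if η ∈ tail then (y i).1 η else 0 := by
    by_cases ht : η ∈ tail
    · have : η ∉ F := fun h => ((hF η).1 h).elim fun _ h => h.2 ht
      simp [ht, this]
    · by_cases hη : η ∈ F
      · simp [ht, hη]
      · have : (y i).1 η = 0 := by
          by_contra h0
          exact hη ((hF η).2 ⟨i, h0, ht⟩)
        simp [this]
  rw [← e1, ← e2] at e3
  simpa [LinearMap.sum_apply, Submodule.coe_sum] using e3.symm

/-! ### Limits along branches, the exact sequence and the cardinality contradiction. -/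

section Limit

variable {M : Type u} [AddCommGroup M] [Module S M] {ι : ∀ n, A n →ₗ[S] M}

theorem map_transition (hι : ∀ n x, ι (n + 1) (f n x) = ι n x) {N n : ℕ} (h : N ≤ n) (x : A N) :
    ι n (transition f h x) = ι N x := by
  induction n, h using Nat.le_induction with
  | base => simp
  | succ n h ih => rw [transition_succ f h, ← ih]; exact hι n _

theorem exists_branchLimit (hι : ∀ n x, ι (n + 1) (f n x) = ι n x) (b : ℕ → X)
    (y : treeModule f X) : ∃ m, ∀ᶠ n in atTop, ι n (y.1 (branchNode b n)) = m := by
  obtain ⟨N, hN⟩ := eventually_atTop.1 (y.2.1 b)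
  refine ⟨ι N (y.1 (branchNode b N)), ?_⟩
  filter_upwards [eventually_ge_atTop N] with n hn
  rw [eq_transition f (x := fun n => y.1 (branchNode b n)) hN hn, map_transition f hι hn]

/-- The limit of a family along a branch. -/
def branchLimit (hι : ∀ n x, ι (n + 1) (f n x) = ι n x) (b : ℕ → X) (y : treeModule f X) : M :=
  Classical.choose (exists_branchLimit f hι b y)

theorem branchLimit_spec (hι : ∀ n x, ι (n + 1) (f n x) = ι n x) (b : ℕ → X)
    (y : treeModule f X) :
    ∀ᶠ n in atTop, ι n (y.1 (branchNode b n)) = branchLimit f hι b y :=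
  Classical.choose_spec (exists_branchLimit f hι b y)

theorem branchLimit_eq (hι : ∀ n x, ι (n + 1) (f n x) = ι n x) {b : ℕ → X}
    {y : treeModule f X} {m : M} (h : ∀ᶠ n in atTop, ι n (y.1 (branchNode b n)) = m) :
    branchLimit f hι b y = m := by
  obtain ⟨n, h1, h2⟩ := (h.and (branchLimit_spec f hι b y)).exists
  exact h2.symm.trans h1

theorem branchLimit_eq_zero (hι : ∀ n x, ι (n + 1) (f n x) = ι n x) {b : ℕ → X}
    {y : treeModule f X} (h : ∀ᶠ n in atTop, y.1 (branchNode b n) = 0) :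
    branchLimit f hι b y = 0 :=
  branchLimit_eq f hι <| h.mono fun n hn => by rw [hn, map_zero]

/-- A branch outside `W` eventually leaves every branch in `W` and the finite exceptional set, so
`y` is eventually zero along it. -/
theorem finite_branchLimit_ne_zero (hι : ∀ n x, ι (n + 1) (f n x) = ι n x)
    (y : treeModule f X) : {b | branchLimit f hι b y ≠ 0}.Finite := by
  obtain ⟨W, hW⟩ := y.2.2
  refine W.finite_toSet.subset fun b hb => ?_
  by_contra hbW
  refine hb (branchLimit_eq_zero f hι ?_)
  have h1 : ∀ᶠ n in atTop, ∀ b' ∈ W, ∀ m, branchNode b n ≠ branchNode b' m := by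
    rw [Finset.eventually_all]
    exact fun b' hb' => eventually_branchNode_ne fun h => hbW (h ▸ hb')
  filter_upwards [h1, eventually_branchNode_notMem b hW] with n h1 h2
  by_contra h0
  exact h2 ⟨h0, h1⟩

/-- The limits along all branches. -/
def treeLimit (hι : ∀ n x, ι (n + 1) (f n x) = ι n x) :
    treeModule f X →ₗ[S] ((ℕ → X) →₀ M) where
  toFun y := Finsupp.ofSupportFinite (fun b => branchLimit f hι b y)
    (finite_branchLimit_ne_zero f hι y)
  map_add' y z := by
    ext b
    refine branchLimit_eq f hι ?_
    filter_upwards [branchLimit_spec f hι b y, branchLimit_spec f hι b z] with n h1 h2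
    rw [Submodule.coe_add, Pi.add_apply, map_add, h1, h2]
    rfl
  map_smul' c y := by
    ext b
    refine branchLimit_eq f hι ?_
    filter_upwards [branchLimit_spec f hι b y] with n h1
    rw [Submodule.coe_smul, Pi.smul_apply, map_smul, h1]
    rfl

theorem treeLimit_apply (hι : ∀ n x, ι (n + 1) (f n x) = ι n x) (y : treeModule f X)
    (b : ℕ → X) : treeLimit f hι y b = branchLimit f hι b y := rfl

theorem treeLimit_threadEmb (hι : ∀ n x, ι (n + 1) (f n x) = ι n x) (b : ℕ → X) (N : ℕ)
    (x : A N) : treeLimit f hι (threadEmb f b N x) = Finsupp.single b (ι N x) := by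
  classical
  ext b'
  rw [treeLimit_apply, Finsupp.single_apply]
  split_ifs with h
  · subst h
    refine branchLimit_eq f hι ?_
    filter_upwards [eventually_ge_atTop N] with n hn
    rw [coe_threadEmb, spread_branchNode, thread_of_le f hn, map_transition f hι hn]
  · refine branchLimit_eq_zero f hι ?_
    filter_upwards [eventually_branchNode_ne (Ne.symm h)] with n hn
    rw [coe_threadEmb, spread_of_ne _ _ hn]

theorem treeLimit_surjective (hι : ∀ n x, ι (n + 1) (f n x) = ι n x)
    (hsurj : ∀ m, ∃ n x, ι n x = m) :
    Function.Surjective (treeLimit (X := X) f hι) := by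
  rw [← LinearMap.range_eq_top, eq_top_iff]
  rintro z -
  induction z using Finsupp.induction_linear with
  | zero => exact zero_mem _
  | add y z hy hz => exact add_mem hy hz
  | single b m =>
    obtain ⟨n, x, rfl⟩ := hsurj m
    exact ⟨threadEmb f b n x, treeLimit_threadEmb f hι b n x⟩

/-- If the limit along `b` is zero, some value of the thread dies at a later stage, and the thread
is zero from there on. As only finitely many branches matter, the support is finite. -/
theorem exact_treeLimit (hι : ∀ n x, ι (n + 1) (f n x) = ι n x)
    (hker : ∀ n x, ι n x = 0 → ∃ (k : ℕ) (h : n ≤ k), transition f h x = 0) :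
    Function.Exact (finiteSupportEmb (X := X) f) (treeLimit f hι) := by
  classical
  intro y
  constructor
  · intro hy
    obtain ⟨W, hW⟩ := y.2.2
    have hb (b : ℕ → X) : {n | y.1 (branchNode b n) ≠ 0}.Finite := by
      have h0 : branchLimit f hι b y = 0 := DFunLike.congr_fun hy b
      have h1 := branchLimit_spec f hι b y
      rw [h0] at h1
      obtain ⟨N, hN⟩ := eventually_atTop.1 ((y.2.1 b).and h1)
      obtain ⟨k, hk, hx⟩ := hker N _ (hN N le_rfl).2
      rw [← eq_transition f (x := fun n => y.1 (branchNode b n)) (fun n hn => (hN n hn).1) hk]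
        at hx
      refine (Set.finite_lt_nat k).subset fun n hn => ?_
      by_contra hkn
      have hkn : k ≤ n := not_lt.1 hkn
      refine hn ?_
      rw [eq_transition f (x := fun n => y.1 (branchNode b n))
        (fun n hn => (hN n (hk.trans hn)).1) hkn, hx, map_zero]
    have hfin : {η | y.1 η ≠ 0}.Finite := by
      refine (hW.union (W.finite_toSet.biUnion fun b _ => (hb b).image (branchNode b))).subset ?_
      intro η hη
      by_cases h : ∀ b ∈ W, ∀ n, η ≠ branchNode b n
      · exact Or.inl ⟨hη, h⟩
      · push Not at h
        obtain ⟨b, hbW, n, rfl⟩ := h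
        exact Or.inr (Set.mem_biUnion hbW ⟨n, hη, rfl⟩)
    refine ⟨DFinsupp.mk hfin.toFinset fun η => y.1 η.1, ?_⟩
    ext η
    rw [finiteSupportEmb_apply, DFinsupp.mk_apply]
    split_ifs with h
    · rfl
    · by_contra h0
      exact h (hfin.mem_toFinset.2 (Ne.symm h0))
  · rintro ⟨z, rfl⟩
    ext b
    refine branchLimit_eq_zero f hι ?_
    have hz : {η | z η ≠ 0}.Finite := z.support.finite_toSet.subset fun η hη => by simpa using hη
    filter_upwards [eventually_branchNode_notMem b hz] with n hn
    rw [finiteSupportEmb_apply]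
    simpa using hn

open Cardinal in
/-- If `Ext¹(L, C)` vanishes for each module `L` of families on a tree, then `Ext¹(-, C)` vanishes
on the limit of the sequence. -/
theorem subsingleton_ext_of_treeModule (hι : ∀ n x, ι (n + 1) (f n x) = ι n x)
    (hsurj : ∀ m, ∃ n x, ι n x = m)
    (hker : ∀ n x, ι n x = 0 → ∃ (k : ℕ) (h : n ≤ k), transition f h x = 0)
    (C : ModuleCat.{u} S)
    (hC : ∀ X : Type u, Subsingleton (Abelian.Ext.{u} (ModuleCat.of S (treeModule f X)) C 1)) :
    Subsingleton (Abelian.Ext.{u} (ModuleCat.of S M) C 1) := by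
  classical
  -- The copy of `ℕ` makes `X` infinite; the other summands make it bound `C` and all `A n`.
  obtain ⟨X, ⟨e⟩, ⟨g⟩⟩ := exists_embedding_set_into_seq ((ULift.{u} ℕ ⊕ C) ⊕ Σ n, A n)
  have hinj : Function.Injective (finiteSupportEmb (X := X) f) := fun a b h => by
    ext η
    exact congrFun (congrArg Subtype.val h) η
  refine subsingleton_ext_of_no_injection C (finiteSupportEmb (X := X) f) (treeLimit f hι) hinj
    (treeLimit_surjective f hι hsurj) (exact_treeLimit f hι hker) (hC X) fun d hd => ?_
  have hX : ℵ₀ ≤ #X := by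
    rw [aleph0_le_mk_iff]
    exact Infinite.of_injective (fun n : ℕ => e (Sum.inl (Sum.inl ⟨n⟩))) fun a b h => by
      simpa using h
  have : Infinite X := aleph0_le_mk_iff.1 hX
  have hC : #C ≤ #X := mk_le_of_injective (f := fun c => e (Sum.inl (Sum.inr c)))
    fun a b h => by simpa using h
  have hA : #(Σ n, A n) ≤ #X := mk_le_of_injective (f := fun c => e (Sum.inr c))
    fun a b h => by simpa using h
  have hnode : #(Node X) ≤ #X := by
    rw [← mk_list_eq_mk X]
    exact mk_le_of_injective (f := fun η : Node X => List.ofFn η.2)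
      fun _ _ h => List.ofFn_inj'.1 h
  have hpair : #((Σ η : Node X, A η.1) × C) ≤ #X := by
    have h1 : #((Σ η : Node X, A η.1) × C) ≤ #((Node X × Σ n, A n) × C) :=
      mk_le_of_injective (f := fun p => ((p.1.1, ⟨p.1.1.1, p.1.2⟩), p.2)) <| by
        rintro ⟨⟨η, a⟩, c⟩ ⟨⟨η', a'⟩, c'⟩ h
        simp only [Prod.mk.injEq] at h
        obtain ⟨⟨rfl, h⟩, rfl⟩ := h
        simpa using h
    refine h1.trans ?_
    rw [mk_prod, mk_prod]
    simp only [lift_id]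
    exact mul_le_of_le hX (mul_le_of_le hX hnode hA) hC
  obtain ⟨e'⟩ := hpair
  -- A homomorphism on the direct sum is determined by its graph on the summands, here coded as a
  -- subset of `X`.
  let graph (h : (Π₀ η : Node X, A η.1) →ₗ[S] C) : Set X :=
    {x | ∃ p : (Σ η : Node X, A η.1) × C, h (DFinsupp.single p.1.1 p.1.2) = p.2 ∧ e' p = x}
  have hgraph : Function.Injective graph := fun h h' hh => by
    refine DFinsupp.lhom_ext fun η a => ?_
    have : e' (⟨η, a⟩, h (DFinsupp.single η a)) ∈ graph h' := hh ▸ ⟨_, rfl, rfl⟩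
    obtain ⟨p, hp, hpe⟩ := this
    rw [e'.injective.eq_iff] at hpe
    subst hpe
    exact hp.symm
  exact Function.cantor_injective _ (g.injective.comp (hgraph.comp hd))

end Limit
end Tree

/-! ### From sequences to countable direct limits. -/

section Sequences

variable {R : Type u} [Ring R]

theorem isPure_treeModule {A : ℕ → Type u} [∀ n, AddCommGroup (A n)] [∀ n, Module Rᵐᵒᵖ (A n)]
    (f : ∀ n, A n →ₗ[Rᵐᵒᵖ] A (n + 1)) (X : Type u) : IsPure (treeModule f X) :=
  isPure_of_locally_split fun _ y => exists_map_fixing f y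

/-- The limit of a sequence of members of a class closed under products is in `⊥𝒞` if the pure
submodules of members of the class are. -/
theorem leftPerp_of_sequence {𝒜 𝒞 : ObjectProperty (ModuleCat.{u} Rᵐᵒᵖ)}
    (hprod : ClosedUnderProducts 𝒜)
    (hpure : ∀ P : ModuleCat.{u} Rᵐᵒᵖ, 𝒜.isoClosure P → ∀ N : Submodule Rᵐᵒᵖ P,
      IsPure N → leftPerp 𝒞 (ModuleCat.of Rᵐᵒᵖ N))
    {A : ℕ → Type u} [∀ n, AddCommGroup (A n)] [∀ n, Module Rᵐᵒᵖ (A n)]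
    (f : ∀ n, A n →ₗ[Rᵐᵒᵖ] A (n + 1)) (hA : ∀ n, 𝒜 (ModuleCat.of Rᵐᵒᵖ (A n)))
    {M : Type u} [AddCommGroup M] [Module Rᵐᵒᵖ M] {ι : ∀ n, A n →ₗ[Rᵐᵒᵖ] M}
    (hι : ∀ n x, ι (n + 1) (f n x) = ι n x) (hsurj : ∀ m, ∃ n x, ι n x = m)
    (hker : ∀ n x, ι n x = 0 → ∃ (k : ℕ) (h : n ≤ k), transition f h x = 0) :
    leftPerp 𝒞 (ModuleCat.of Rᵐᵒᵖ M) := fun C hC =>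
  subsingleton_ext_of_treeModule f hι hsurj hker C fun X =>
    hpure _ (hprod (fun η : Node X => ModuleCat.of Rᵐᵒᵖ (A η.1)) fun η => hA η.1) _
      (isPure_treeModule f X) C hC

theorem containsCountableDirectLimits_leftPerp {𝒜 𝒞 : ObjectProperty (ModuleCat.{u} Rᵐᵒᵖ)}
    (hprod : ClosedUnderProducts 𝒜)
    (hpure : ∀ P : ModuleCat.{u} Rᵐᵒᵖ, 𝒜.isoClosure P → ∀ N : Submodule Rᵐᵒᵖ P,
      IsPure N → leftPerp 𝒞 (ModuleCat.of Rᵐᵒᵖ N)) :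
    ContainsCountableDirectLimits (leftPerp 𝒞) 𝒜 := by
  intro J _ _ _ _ F hF c hc
  have := Limits.preservesFilteredColimitsOfSize_shrink.{0, u, 0, u}
    (forget (ModuleCat.{u} Rᵐᵒᵖ))
  have := Limits.PreservesFilteredColimitsOfSize.preserves_filtered_colimits
    (F := forget (ModuleCat.{u} Rᵐᵒᵖ)) J
  have : Encodable J := Encodable.ofCountable J
  have : Inhabited J := Classical.inhabited_of_nonempty inferInstance
  have hdir : Directed (· ≤ ·) (id : J → J) := directed_id
  -- A monotone cofinal sequence: it passes `a` at index `encode a + 1`.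
  let j : ℕ → J := hdir.sequence id
  have hj : Monotone j := hdir.sequence_mono
  have hle (a : J) : a ≤ j (Encodable.encode a + 1) := hdir.le_sequence a
  let f (n : ℕ) : F.obj (j n) →ₗ[Rᵐᵒᵖ] F.obj (j (n + 1)) := (F.map (homOfLE (hj n.le_succ))).hom
  have htr {n k : ℕ} (h : n ≤ k) (x : F.obj (j n)) :
      transition f h x = (F.map (homOfLE (hj h))).hom x := by
    induction k, h using Nat.le_induction with
    | base =>
      rw [transition_self, show homOfLE (hj (le_refl n)) = 𝟙 _ from rfl, F.map_id]
      rfl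
    | succ k h ih =>
      rw [transition_succ f h, LinearMap.comp_apply, ih,
        show homOfLE (hj (h.trans k.le_succ)) = homOfLE (hj h) ≫ homOfLE (hj k.le_succ) from rfl,
        F.map_comp]
      rfl
  have hw {a b : J} (h : a ⟶ b) (x : F.obj a) :
      (c.ι.app b).hom ((F.map h).hom x) = (c.ι.app a).hom x := by
    rw [← c.w h]
    rfl
  refine leftPerp_of_sequence (M := c.pt) hprod hpure f (fun n => hF (j n))
    (ι := fun n => (c.ι.app (j n)).hom) (fun n x => hw _ x) (fun m => ?_) fun n x hx => ?_
  · obtain ⟨a, x, rfl⟩ := Limits.Concrete.isColimit_exists_rep F hc m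
    exact ⟨_, (F.map (homOfLE (hle a))).hom x, hw _ x⟩
  · obtain ⟨b, g, g', h⟩ := (Limits.Concrete.isColimit_rep_eq_iff_exists F hc x
      (0 : F.obj (j n))).1 (hx.trans (map_zero _).symm)
    have h0 : (F.map g).hom x = 0 := h.trans (map_zero _)
    let k := max n (Encodable.encode b + 1)
    have hbk : b ≤ j k := (hle b).trans (hj (le_max_right _ _))
    refine ⟨k, le_max_left _ _, ?_⟩
    rw [htr, show homOfLE (hj (le_max_left n _)) = g ≫ homOfLE hbk from rfl, F.map_comp]
    exact (congrArg (F.map (homOfLE hbk)).hom h0).trans (map_zero _)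

/-- An isomorphism is a pure embedding, so inheritance along pure embeddings also handles the
isomorphism closure. -/
theorem flatMittagLeffler_of_isPure {𝒬 : ObjectProperty (ModuleCat.{u} R)}
    {P : ModuleCat.{u} Rᵐᵒᵖ} (hP : (flatMittagLeffler 𝒬).isoClosure P) {N : Submodule Rᵐᵒᵖ P}
    (hN : IsPure N) : flatMittagLeffler 𝒬 (ModuleCat.of Rᵐᵒᵖ N) := by
  obtain ⟨P', hP', ⟨e⟩⟩ := hP
  have he : IsPureEmbedding e.hom.hom :=
    isPureEmbedding_of_comp_eq_id (q := e.inv.hom) (by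
      rw [← ModuleCat.hom_comp, e.hom_inv_id, ModuleCat.hom_id])
  have hN' : IsPureEmbedding N.subtype := hN
  exact ⟨hN'.isFlat (he.isFlat hP'.1), hN'.isMittagLeffler (he.isMittagLeffler hP'.2)⟩

theorem le_leftPerp_rightPerp (𝒜 : ObjectProperty (ModuleCat.{u} Rᵐᵒᵖ)) :
    𝒜 ≤ leftPerp (rightPerp 𝒜) := fun M hM _ hC => hC M hM

end Sequences

/-! ### Countably presented flat modules as limits of sequences. -/

section CountablyPresented

open Filter

variable {R : Type u} [Ring R] {M : Type u} [AddCommGroup M] [Module Rᵐᵒᵖ M]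

/-- In a flat module, an element of the kernel of a homomorphism from a finitely generated free
module is killed in a factorization through another one. -/
theorem IsFlat.exists_killing (h : IsFlat R M) {k : ℕ} (w : (Fin k → Rᵐᵒᵖ) →ₗ[Rᵐᵒᵖ] M)
    (x : Fin k → Rᵐᵒᵖ) (hx : w x = 0) :
    ∃ (l : ℕ) (β : (Fin k → Rᵐᵒᵖ) →ₗ[Rᵐᵒᵖ] (Fin l → Rᵐᵒᵖ)) (w' : (Fin l → Rᵐᵒᵖ) →ₗ[Rᵐᵒᵖ] M),
      w' ∘ₗ β = w ∧ β x = 0 := by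
  obtain ⟨l, κ, y, hκ, hy⟩ := h.exists_factorization (fun i => w (Pi.single i 1))
    (fun i => (x i).unop) (by
      rw [LinearMap.pi_apply_eq_sum_univ w x] at hx
      rw [← hx]
      refine Finset.sum_congr rfl fun i _ => ?_
      rw [MulOpposite.op_unop]
      congr 2
      ext j
      simp [Pi.single_apply, eq_comm])
  refine ⟨l, Fintype.linearCombination Rᵐᵒᵖ fun i s => MulOpposite.op (κ s i),
    Fintype.linearCombination Rᵐᵒᵖ y, ?_, ?_⟩
  · refine LinearMap.pi_ext' fun i => LinearMap.ext_ring ?_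
    simp [Fintype.linearCombination_apply, hy, Pi.single_apply]
  · ext s
    have := congrArg MulOpposite.op (hκ s)
    simpa [Fintype.linearCombination_apply, Finset.sum_apply] using this

/-- The elements are killed one at a time: factorizations compose, and what is already killed stays
killed. -/
theorem IsFlat.exists_killing_family (h : IsFlat R M) {k : ℕ} (w : (Fin k → Rᵐᵒᵖ) →ₗ[Rᵐᵒᵖ] M)
    (x : ℕ → Fin k → Rᵐᵒᵖ) (n : ℕ) (hx : ∀ i < n, w (x i) = 0) :
    ∃ (l : ℕ) (β : (Fin k → Rᵐᵒᵖ) →ₗ[Rᵐᵒᵖ] (Fin l → Rᵐᵒᵖ)) (w' : (Fin l → Rᵐᵒᵖ) →ₗ[Rᵐᵒᵖ] M),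
      w' ∘ₗ β = w ∧ ∀ i < n, β (x i) = 0 := by
  induction n with
  | zero => exact ⟨k, LinearMap.id, w, rfl, by simp⟩
  | succ n ih =>
    obtain ⟨l, β, w', hβ, hβx⟩ := ih fun i hi => hx i (hi.trans n.lt_succ_self)
    obtain ⟨l', β', w'', hβ', hβx'⟩ := h.exists_killing w' (β (x n)) (by
      rw [← LinearMap.comp_apply, hβ, hx n n.lt_succ_self])
    refine ⟨l', β' ∘ₗ β, w'', by rw [← LinearMap.comp_assoc, hβ', hβ], fun i hi => ?_⟩
    rcases Nat.lt_succ_iff_lt_or_eq.1 hi with hi | rfl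
    · simp [hβx i hi]
    · exact hβx'

/-- A homomorphism from a free module to a flat module, restricted to finitely many basis vectors,
factors through a finitely generated free module so that given relations are killed. -/
theorem IsFlat.exists_killing_finsupp (h : IsFlat R M) {ι : Type}
    (p : (ι →₀ Rᵐᵒᵖ) →ₗ[Rᵐᵒᵖ] M) (T : Finset ι) (x : ℕ → ι →₀ Rᵐᵒᵖ) (n : ℕ)
    (hx : ∀ i < n, p (x i) = 0) (hT : ∀ i < n, x i ∈ Finsupp.supported Rᵐᵒᵖ Rᵐᵒᵖ (T : Set ι)) :
    ∃ (l : ℕ) (α : (ι →₀ Rᵐᵒᵖ) →ₗ[Rᵐᵒᵖ] (Fin l → Rᵐᵒᵖ)) (w : (Fin l → Rᵐᵒᵖ) →ₗ[Rᵐᵒᵖ] M),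
      (∀ c ∈ Finsupp.supported Rᵐᵒᵖ Rᵐᵒᵖ (T : Set ι), w (α c) = p c) ∧ ∀ i < n, α (x i) = 0 := by
  classical
  let e := T.equivFin
  let α₀ : (ι →₀ Rᵐᵒᵖ) →ₗ[Rᵐᵒᵖ] (Fin T.card → Rᵐᵒᵖ) :=
    LinearMap.pi fun i => Finsupp.lapply (e.symm i).1
  let w₀ : (Fin T.card → Rᵐᵒᵖ) →ₗ[Rᵐᵒᵖ] M :=
    Fintype.linearCombination Rᵐᵒᵖ fun i => p (Finsupp.single (e.symm i).1 1)
  have h₀ : ∀ c ∈ Finsupp.supported Rᵐᵒᵖ Rᵐᵒᵖ (T : Set ι), w₀ (α₀ c) = p c := by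
    intro c hc
    have hc' : c.support ⊆ T := by simpa [Finsupp.mem_supported] using hc
    have h1 : c = ∑ i ∈ T, c i • Finsupp.single i (1 : Rᵐᵒᵖ) := by
      conv_lhs => rw [← c.sum_single]
      rw [Finsupp.sum_of_support_subset c hc' _ (by simp)]
      simp
    conv_rhs => rw [h1]
    simp only [w₀, α₀, Fintype.linearCombination_apply, map_sum, map_smul, LinearMap.pi_apply,
      Finsupp.lapply_apply]
    rw [← Finset.sum_coe_sort T]
    exact Equiv.sum_comp e.symm fun i : T => c i.1 • p (Finsupp.single i.1 1)
  obtain ⟨l, β, w, hβ, hβx⟩ := h.exists_killing_family w₀ (fun i => α₀ (x i)) n fun i hi => by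
    rw [h₀ _ (hT i hi), hx i hi]
  refine ⟨l, β ∘ₗ α₀, w, fun c hc => ?_, hβx⟩
  rw [LinearMap.comp_apply, ← LinearMap.comp_apply w β, hβ, h₀ c hc]

/-- A countably presented flat module is the limit of a sequence of finitely generated free
modules. -/
theorem IsFlat.exists_sequence (h : IsFlat R M) (hM : IsCountablyPresented R M) :
    ∃ (l : ℕ → ℕ) (f : ∀ n, (Fin (l n) → Rᵐᵒᵖ) →ₗ[Rᵐᵒᵖ] (Fin (l (n + 1)) → Rᵐᵒᵖ))
      (w : ∀ n, (Fin (l n) → Rᵐᵒᵖ) →ₗ[Rᵐᵒᵖ] M),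
      (∀ n x, w (n + 1) (f n x) = w n x) ∧ (∀ m, ∃ n x, w n x = m) ∧
      ∀ n x, w n x = 0 → ∃ (k : ℕ) (hk : n ≤ k),
        transition (A := fun n => Fin (l n) → Rᵐᵒᵖ) f hk x = 0 := by
  classical
  obtain ⟨ι, _, p, hp, S, hS, hSp⟩ := hM
  have : Encodable ι := Encodable.ofCountable ι
  -- Adjoining `0` makes the countable generating set nonempty, so a sequence enumerates it.
  obtain ⟨x, hxS⟩ := (hS.insert 0).exists_eq_range (Set.insert_nonempty _ _)
  have hxp : Submodule.span Rᵐᵒᵖ (Set.range x) = LinearMap.ker p := by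
    rw [← hxS, Submodule.span_insert_zero, hSp]
  have hx0 (i : ℕ) : p (x i) = 0 := by
    have : x i ∈ LinearMap.ker p := hxp ▸ Submodule.subset_span ⟨i, rfl⟩
    exact this
  let K (n : ℕ) : Submodule Rᵐᵒᵖ (ι →₀ Rᵐᵒᵖ) := Submodule.span Rᵐᵒᵖ (x '' Set.Iio n)
  have hKmono : Monotone K := fun a b hab =>
    Submodule.span_mono (Set.image_mono (Set.Iio_subset_Iio hab))
  have hK (c : ι →₀ Rᵐᵒᵖ) (hc : p c = 0) : ∀ᶠ n in atTop, c ∈ K n := by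
    replace hc : c ∈ Submodule.span Rᵐᵒᵖ (Set.range x) := by rw [hxp]; exact hc
    induction hc using Submodule.span_induction with
    | mem c hc =>
      obtain ⟨i, rfl⟩ := hc
      filter_upwards [eventually_gt_atTop i] with n hn
      exact Submodule.subset_span ⟨i, hn, rfl⟩
    | zero => exact Eventually.of_forall fun n => zero_mem _
    | add a b ha hb iha ihb =>
      filter_upwards [iha, ihb] with n h1 h2
      exact add_mem h1 h2
    | smul r a ha iha =>
      filter_upwards [iha] with n h1
      exact Submodule.smul_mem _ r h1
  let T (n : ℕ) : Finset ι := ((Finset.range n).biUnion fun i => (x i).support) ∪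
    (Finset.range n).biUnion fun i => (Encodable.decode (α := ι) i).toFinset
  have hTmono : Monotone T := fun a b hab =>
    Finset.union_subset_union (Finset.biUnion_subset_biUnion_of_subset_left _
      (Finset.range_mono hab)) (Finset.biUnion_subset_biUnion_of_subset_left _
      (Finset.range_mono hab))
  let G (n : ℕ) : Submodule Rᵐᵒᵖ (ι →₀ Rᵐᵒᵖ) := Finsupp.supported Rᵐᵒᵖ Rᵐᵒᵖ (T n : Set ι)
  have hGmono : Monotone G := fun a b hab =>
    Finsupp.supported_mono (Finset.coe_subset.2 (hTmono hab))
  have hxG (n i : ℕ) (hi : i < n) : x i ∈ G n := by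
    refine (Finsupp.mem_supported _ _).2 (Finset.coe_subset.2 fun a ha => ?_)
    exact Finset.mem_union_left _ (Finset.mem_biUnion.2 ⟨i, Finset.mem_range.2 hi, ha⟩)
  have hG (c : ι →₀ Rᵐᵒᵖ) : ∀ᶠ n in atTop, c ∈ G n := by
    have : ∀ᶠ n in atTop, ∀ a ∈ c.support, a ∈ T n := by
      rw [Finset.eventually_all]
      intro a _
      filter_upwards [eventually_gt_atTop (Encodable.encode a)] with n hn
      refine Finset.mem_union_right _ (Finset.mem_biUnion.2 ⟨_, Finset.mem_range.2 hn, ?_⟩)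
      simp
    filter_upwards [this] with n hn
    exact (Finsupp.mem_supported _ _).2 (Finset.coe_subset.2 hn)
  choose l α w hw hα using fun n => h.exists_killing_finsupp p (T n) x n (fun i _ => hx0 i) (hxG n)
  have hαK (n : ℕ) (c) (hc : c ∈ K n) : α n c = 0 := by
    have : K n ≤ LinearMap.ker (α n) := Submodule.span_le.2 <| by
      rintro _ ⟨i, hi, rfl⟩
      exact hα n i hi
    exact this hc
  have hv (n : ℕ) : ∃ v : (Fin (l n) → Rᵐᵒᵖ) →ₗ[Rᵐᵒᵖ] (ι →₀ Rᵐᵒᵖ), p ∘ₗ v = w n := by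
    choose z hz using fun i => hp (w n (Pi.single i 1))
    refine ⟨Fintype.linearCombination Rᵐᵒᵖ z, ?_⟩
    refine LinearMap.pi_ext' fun i => LinearMap.ext_ring ?_
    simp [Fintype.linearCombination_apply, hz, Pi.single_apply]
  choose v hv using hv
  have hv' (n : ℕ) (c) : p (v n c) = w n c := LinearMap.congr_fun (hv n) c
  -- `v n` lifts `w n` to the free module, so `v n ∘ α n` agrees with the identity on `G n` modulo
  -- `ker p`. As `G n` is finitely generated, a single `K k` contains all the differences.
  have hnext (n : ℕ) : ∃ k, n < k ∧ (∀ c, v n c ∈ G k) ∧ ∀ c ∈ G n, v n (α n c) - c ∈ K k := by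
    have h1 : ∀ᶠ k in atTop, ∀ i, v n (Pi.single i 1) ∈ G k :=
      eventually_all.2 fun i => hG _
    have h2 : ∀ᶠ k in atTop, ∀ i ∈ T n,
        v n (α n (Finsupp.single i 1)) - Finsupp.single i 1 ∈ K k := by
      rw [Finset.eventually_all]
      intro i hi
      refine hK _ ?_
      rw [map_sub, hv', hw n _ (Finsupp.single_mem_supported _ _ hi), sub_self]
    obtain ⟨k, h1, h2, hk⟩ := (h1.and (h2.and (eventually_gt_atTop n))).exists
    refine ⟨k, hk, fun c => ?_, fun c hc => ?_⟩
    · rw [LinearMap.pi_apply_eq_sum_univ (v n) c]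
      refine sum_mem fun i _ => Submodule.smul_mem _ _ ?_
      convert h1 i using 2
      ext j
      simp [Pi.single_apply, eq_comm]
    · have : G n ≤ (K k).comap (v n ∘ₗ α n - LinearMap.id) := by
        simp only [G]
        rw [Finsupp.supported_eq_span_single, Submodule.span_le]
        rintro _ ⟨i, hi, rfl⟩
        exact h2 i hi
      exact this hc
  choose φ hφ hφG hφK using hnext
  let N : ℕ → ℕ := fun n => φ^[n] 0
  have hN (n : ℕ) : N (n + 1) = φ (N n) := Function.iterate_succ_apply' φ n 0
  have hNmono : StrictMono N := strictMono_nat_of_lt_succ fun n => by rw [hN]; exact hφ _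
  have hvG (n : ℕ) (c) : v (N n) c ∈ G (N (n + 1)) := by rw [hN]; exact hφG _ c
  have hvK (n : ℕ) (c) (hc : c ∈ G (N n)) : v (N n) (α (N n) c) - c ∈ K (N (n + 1)) := by
    rw [hN]; exact hφK _ c hc
  let f (n : ℕ) : (Fin (l (N n)) → Rᵐᵒᵖ) →ₗ[Rᵐᵒᵖ] (Fin (l (N (n + 1))) → Rᵐᵒᵖ) :=
    α (N (n + 1)) ∘ₗ v (N n)
  refine ⟨fun n => l (N n), f, fun n => w (N n), fun n c => ?_, fun m => ?_, fun n c hc => ?_⟩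
  · rw [← hv' (N n)]
    exact hw _ _ (hvG n c)
  · obtain ⟨c, rfl⟩ := hp m
    obtain ⟨n, hn⟩ := (hNmono.tendsto_atTop.eventually (hG c)).exists
    exact ⟨n, α (N n) c, hw _ _ hn⟩
  -- Transitions telescope: replacing `v ∘ α` by the identity costs an element of `K (N (k + 1))`,
  -- which the next `α` kills. So an element of `ker w` dies once its lift lies in `K (N k)`.
  · have htr (k : ℕ) (hk : n + 1 ≤ k) :
        transition (A := fun n => Fin (l (N n)) → Rᵐᵒᵖ) f ((Nat.le_succ n).trans hk) c =
          α (N k) (v (N n) c) := by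
      induction k, hk using Nat.le_induction with
      | base =>
        rw [transition_succ (A := fun n => Fin (l (N n)) → Rᵐᵒᵖ) f (le_refl n), transition_self]
        rfl
      | succ k hk ih =>
        rw [transition_succ (A := fun n => Fin (l (N n)) → Rᵐᵒᵖ) f ((Nat.le_succ n).trans hk),
          LinearMap.comp_apply, ih]
        have h1 := hαK _ _ (hvK k (v (N n) c) (hGmono (hNmono.monotone hk) (hvG n c)))
        rw [map_sub, sub_eq_zero] at h1
        exact h1
    have h1 := hNmono.tendsto_atTop.eventually (hK (v (N n) c) (by rw [hv', hc]))
    obtain ⟨k, h1, hk⟩ := (h1.and (eventually_ge_atTop (n + 1))).exists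
    exact ⟨k, (Nat.le_succ n).trans hk, by rw [htr k hk, hαK _ _ h1]⟩

end CountablyPresented

end RightMod

end

theorem mainTheorem10 {R : Type u} [Ring R] :
    (∀ 𝒜' 𝒜 𝒞 : ObjectProperty (ModuleCat.{u} Rᵐᵒᵖ),
      RightMod.ClosedUnderProducts 𝒜' →
      𝒜' ≤ 𝒜 →
      𝒜 = RightMod.leftPerp 𝒞 →
      RightMod.ClosedUnderPureSubmodules 𝒜 →
      RightMod.ContainsCountableDirectLimits 𝒜 𝒜') ∧
    (∀ 𝒬 : ObjectProperty (ModuleCat.{u} R),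
      RightMod.ClosedUnderProducts (RightMod.flatMittagLeffler 𝒬) →
      RightMod.ContainsCountableDirectLimits
        (RightMod.leftPerp (RightMod.rightPerp (RightMod.flatMittagLeffler 𝒬)))
        (RightMod.flatMittagLeffler 𝒬) ∧
      ∀ M : ModuleCat.{u} Rᵐᵒᵖ,
        RightMod.IsCountablyPresented R M → RightMod.IsFlat R M →
          RightMod.leftPerp (RightMod.rightPerp (RightMod.flatMittagLeffler 𝒬)) M) ∧
    (IsNoetherianRing R → ∀ 𝒬 : ObjectProperty (ModuleCat.{u} R),
      RightMod.ClosedUnderProducts (RightMod.flatMittagLeffler 𝒬)) := by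
  refine ⟨?_, ?_, ?_⟩
  · rintro 𝒜' _ 𝒞 hprod hle rfl hpure
    -- A product is only isomorphic to a member of `𝒜'`; it lies in `𝒜` because `leftPerp` is
    -- invariant under isomorphism.
    refine RightMod.containsCountableDirectLimits_leftPerp hprod fun P hP N hN => hpure P ?_ N hN
    obtain ⟨P', hP', ⟨e⟩⟩ := hP
    exact RightMod.leftPerp_of_iso e (hle _ hP')
  · intro 𝒬 hprod
    have hpure (P : ModuleCat.{u} Rᵐᵒᵖ) (hP : (RightMod.flatMittagLeffler 𝒬).isoClosure P)
        (N : Submodule Rᵐᵒᵖ P) (hN : RightMod.IsPure N) :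
        RightMod.leftPerp (RightMod.rightPerp (RightMod.flatMittagLeffler 𝒬))
          (ModuleCat.of Rᵐᵒᵖ N) :=
      RightMod.le_leftPerp_rightPerp _ _ (RightMod.flatMittagLeffler_of_isPure hP hN)
    refine ⟨RightMod.containsCountableDirectLimits_leftPerp hprod hpure, fun M hM hflat => ?_⟩
    obtain ⟨l, f, w, hw, hsurj, hker⟩ := hflat.exists_sequence hM
    exact RightMod.leftPerp_of_sequence (A := fun n => Fin (l n) → Rᵐᵒᵖ) hprod hpure f
      (fun n => ⟨RightMod.isFlat_fin _, RightMod.isMittagLeffler_fin 𝒬 _⟩) hw hsurj hker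
  · intro _ 𝒬
    exact RightMod.closedUnderProducts_flatMittagLeffler 𝒬
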